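/- Let $b>0$ and $z\ge 0$. Let $J^*(b,z)$ denote the probability distribution on $[0,\infty)$ with Laplace transform $$\int e^{-tx}\,J^*(b,z)(dx)=\cosh^{b}(z)\,\cosh^{-b}\!\big(\sqrt{2t+z^2}\big),\qquad t\ge 0 .$$ Let $\mathrm{PG}(b)$ denote the distribution with a density $p_{PG}(x\mid b)$ on $(0,\infty)$ with respect to Lebesgue measure whose Laplace transform is $\int_0^\infty e^{-tx}p_{PG}(x\mid b)\,dx=\cosh^{-b}(\sqrt{t/2})$ for $t\ge 0$, and let $\mathrm{PG}(b,z)$ denote the distribution on $(0,\infty)$ with density $\cosh^{b}(z/2)\,e^{-xz^2/2}\,p_{PG}(x\mid b)$. Put $$d_n=\frac{\pi^2}{2}\Big(n+\frac12\Big)^2+\frac{z^2}{2},\qquad n=0,1,2,\dots$$ Then the distributions $J^*(b,z)$ and $\mathrm{PG}(b,z)$ exist and are unique, and: 1. $\mathrm{PG}(b,z)=\frac14 J^*(b,z/2)$; that is, if $X\sim J^*(b,z/2)$, then $X/4\sim \mathrm{PG}(b,z)$. 2. If $X\sim J^*(b,z)$, then $\mathbb E[e^{-tX}]=\prod_{n=0}^\infty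 (1+t/d_n)^{-b}$ for all real $t>-d_0$. The moment generating function $M(t)=\mathbb E[e^{tX}]$ is finite exactly for real $t<d_0$, and for these $t$ $$M(t)=\prod_{n=0}^\infty\Big(1-\frac{t}{d_n}\Big)^{-b}=\cosh^b(z)\,\cos^{-b}\!\big(\sqrt{2t-z^2}\big),$$ where for $2t<z^2$ the square root is imaginary, so that $\cos\sqrt{2t-z^2}=\cosh\sqrt{z^2-2t}$. 3. If $g_0,g_1,\dots$ are i.i.d. with distribution $\mathrm{Ga}(b,1)$ (shape $b$, rate $1$), then the series $\sum_{n=0}^\infty g_n/d_n$ converges almost surely and its sum has distribution $J^*(b,z)$. -/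

import Mathlib

open MeasureTheory ProbabilityTheory
open scoped ENNReal

/-- `IsJStar b z μ`: the measure `μ` is the distribution `J*(b, z)`, that is, the probability
distribution on `[0, ∞)` whose Laplace transform is `cosh(z)^b * cosh(√(2t + z²))^(-b)`. -/
structure IsJStar (b z : ℝ) (μ : Measure ℝ) : Prop where
  isProbabilityMeasure : IsProbabilityMeasure μ
  nonneg_support : μ (Set.Iio 0) = 0
  laplace : ∀ t : ℝ, 0 ≤ t →
    ∫ x, Real.exp (-(t * x)) ∂μ = Real.cosh z ^ b * Real.cosh (√(2 * t + z ^ 2)) ^ (-b)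

/-- `IsPolyaGammaDensity b p`: the function `p` is (a version of) the density of `PG(b)` on
`(0, ∞)` with respect to Lebesgue measure, characterized by its Laplace transform
`cosh(√(t/2))^(-b)`. -/
structure IsPolyaGammaDensity (b : ℝ) (p : ℝ → ℝ≥0∞) : Prop where
  measurable : Measurable p
  laplace : ∀ t : ℝ, 0 ≤ t →
    ∫⁻ x in Set.Ioi (0 : ℝ), ENNReal.ofReal (Real.exp (-(t * x))) * p x =
      ENNReal.ofReal (Real.cosh (√(t / 2)) ^ (-b))

/-- `IsPolyaGamma b z ν`: the measure `ν` is the Pólya-Gamma distribution `PG(b, z)`, that is, the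
measure on `(0, ∞)` with Lebesgue density `cosh(z/2)^b * exp(-x z²/2) * p(x)`, where `p` is the
density of `PG(b)`. -/
def IsPolyaGamma (b z : ℝ) (ν : Measure ℝ) : Prop :=
  ∃ p : ℝ → ℝ≥0∞, IsPolyaGammaDensity b p ∧
    ν = (volume.restrict (Set.Ioi (0 : ℝ))).withDensity
      (fun x => ENNReal.ofReal (Real.cosh (z / 2) ^ b * Real.exp (-(x * z ^ 2 / 2))) * p x)

/-- The rates `d_n = (π²/2) (n + 1/2)² + z²/2`. -/
noncomputable def jstarRate (z : ℝ) (n : ℕ) : ℝ :=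
  Real.pi ^ 2 / 2 * ((n : ℝ) + 1 / 2) ^ 2 + z ^ 2 / 2

/-! Everything is read off from the series `∑ g_n / d_n`. Its exponential moment at `t < d_0` is `∏
(1 - t/d_n)^(-b)`. With `q_n = π²(n + 1/2)²`, each factor `1 - t/d_n` is the quotient of `1 - w/q_n`
at `w = 2t - z²` and at `w = -z²`, so Euler's product for the cosine gives the closed form
(`tendsto_prod_one_sub_div_jstarRate`). Thus the law of the series is a `J*(b, z)`.

A finite measure on `[0, ∞)` is determined by its Laplace transform (`ext_of_laplace_eq`): `x ↦
e^(-x)` turns the values at integers into moments on `[0, 1]`, and polynomials are dense there.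
Hence every `J*(b, z)` is the law of the series and inherits its exponential moments, including
their divergence for `t ≥ d_0`, which the first term already forces.

Splitting off that first term writes `J*(b, z)` as a convolution with a gamma law, so it has a
density; for `z = 0`, rescaling by `1/4` gives the density of `PG(b)`. The tilt `e^(-xz²/2)` shifts
the Laplace variable by `z²/2`, and uniqueness then identifies `PG(b, z)` with the law of `X/4`. -/

/-! ### Uniqueness of Laplace transforms -/

/-- The star subalgebra of polynomial functions on the unit interval. -/
noncomputable def polynomialStarSubalgebra :
    StarSubalgebra ℝ (BoundedContinuousFunction unitInterval ℝ) where
  carrier := {f | ∃ p : Polynomial ℝ, ∀ x, f x = p.eval (x : ℝ)}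
  mul_mem' := by
    rintro f g ⟨p, hp⟩ ⟨q, hq⟩
    exact ⟨p * q, fun x => by simp [hp, hq]⟩
  add_mem' := by
    rintro f g ⟨p, hp⟩ ⟨q, hq⟩
    exact ⟨p + q, fun x => by simp [hp, hq]⟩
  algebraMap_mem' r := ⟨Polynomial.C r, fun x => by simp⟩
  star_mem' := by
    rintro f ⟨p, hp⟩
    exact ⟨p, fun x => by simp [hp]⟩

/-- Finite measures on the unit interval are determined by their moments. -/
theorem ext_of_integral_pow_unitInterval {μ ν : Measure unitInterval} [IsFiniteMeasure μ]
    [IsFiniteMeasure ν] (h : ∀ n : ℕ, ∫ x, (x : ℝ) ^ n ∂μ = ∫ x, (x : ℝ) ^ n ∂ν) : μ = ν := by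
  refine ext_of_forall_mem_subalgebra_integral_eq_of_polish (𝕜 := ℝ)
    (A := polynomialStarSubalgebra) ?_ ?_
  · intro x y hxy
    refine ⟨_, ⟨_, ⟨BoundedContinuousFunction.mkOfCompact ⟨fun x : unitInterval => (x : ℝ),
      continuous_subtype_val⟩, ⟨Polynomial.X, fun x => by simp⟩, rfl⟩, rfl⟩, ?_⟩
    simpa [Subtype.ext_iff] using hxy
  · rintro f ⟨p, hp⟩
    have hint : ∀ (κ : Measure unitInterval) [IsFiniteMeasure κ] (i : ℕ),
        Integrable (fun x : unitInterval => p.coeff i * (x : ℝ) ^ i) κ := fun κ _ i => by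
      refine Continuous.integrable_of_hasCompactSupport (by fun_prop) ?_
      exact HasCompactSupport.of_compactSpace _
    simp_rw [hp, Polynomial.eval_eq_sum_range]
    rw [integral_finsetSum _ fun i _ => hint μ i, integral_finsetSum _ fun i _ => hint ν i]
    simp_rw [integral_const_mul, h]

theorem ae_nonneg_of_Iio_zero {μ : Measure ℝ} (h : μ (Set.Iio 0) = 0) : ∀ᵐ x ∂μ, 0 ≤ x := by
  rw [ae_iff]
  simpa [Set.Iio] using h

/-- Finite measures on `[0, ∞)` are determined by their Laplace transforms. -/
theorem ext_of_laplace_eq {μ ν : Measure ℝ} [IsFiniteMeasure μ] [IsFiniteMeasure ν]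
    (hμ : μ (Set.Iio 0) = 0) (hν : ν (Set.Iio 0) = 0)
    (h : ∀ t : ℝ, 0 ≤ t → ∫⁻ x, ENNReal.ofReal (Real.exp (-(t * x))) ∂μ =
      ∫⁻ x, ENNReal.ofReal (Real.exp (-(t * x))) ∂ν) : μ = ν := by
  -- Truncating at `0` keeps the values in `[0, 1]` everywhere; it changes nothing almost
  -- everywhere, and `ψ` below inverts `φ` on `[0, ∞)`.
  let φ : ℝ → unitInterval := fun x =>
    ⟨Real.exp (-(max x 0)), (Real.exp_pos _).le, Real.exp_le_one_iff.2 (by simp)⟩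
  have hφ : Measurable φ := by
    refine Measurable.subtype_mk ?_
    fun_prop
  let ψ : unitInterval → ℝ := fun y => -Real.log y
  have hψ : Measurable ψ := by fun_prop
  have hrec : ∀ κ : Measure ℝ, κ (Set.Iio 0) = 0 → (κ.map φ).map ψ = κ := fun κ hκ => by
    rw [Measure.map_map hψ hφ]
    conv_rhs => rw [← Measure.map_id (μ := κ)]
    refine Measure.map_congr ?_
    filter_upwards [ae_nonneg_of_Iio_zero hκ] with x hx
    simp [φ, ψ, hx]
  have hmom : ∀ κ : Measure ℝ, κ (Set.Iio 0) = 0 → ∀ n : ℕ, ∫ x, (x : ℝ) ^ n ∂(κ.map φ) =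
      (∫⁻ x, ENNReal.ofReal (Real.exp (-((n : ℝ) * x))) ∂κ).toReal := fun κ hκ n => by
    rw [integral_map hφ.aemeasurable (by fun_prop), ← integral_eq_lintegral_of_nonneg_ae
      (Filter.Eventually.of_forall fun x => (Real.exp_pos _).le) (by fun_prop)]
    refine integral_congr_ae ?_
    filter_upwards [ae_nonneg_of_Iio_zero hκ] with x hx
    simp only [φ, max_eq_left hx, ← Real.exp_nat_mul]
    ring_nf
  have : μ.map φ = ν.map φ := ext_of_integral_pow_unitInterval fun n => by
    rw [hmom μ hμ, hmom ν hν, h n n.cast_nonneg]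
  rw [← hrec μ hμ, ← hrec ν hν, this]

/-! ### Euler's product for the cosine -/

-- Divide Euler's product for `sin (2πy)` by twice that for `sin (πy)`. Of the first `2N` factors of
-- the former, every second one cancels against the latter, and the others carry the half-integers.
-- The division needs `sin (πy) ≠ 0`; the case `y = 0` is trivial.
open Filter Topology in
theorem tendsto_cos_prod {y : ℂ} (hy : y = 0 ∨ Complex.sin (Real.pi * y) ≠ 0) :
    Tendsto (fun N : ℕ => ∏ j ∈ Finset.range N, (1 - y ^ 2 / ((j : ℂ) + 1 / 2) ^ 2)) atTop
      (𝓝 (Complex.cos (Real.pi * y))) := by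
  rcases hy with rfl | hy
  · simp
  have hy0 : y ≠ 0 := by
    rintro rfl
    simp at hy
  have h1 := Complex.tendsto_euler_sin_prod y
  have h2 := (Complex.tendsto_euler_sin_prod (2 * y)).comp
    (tendsto_id.const_mul_atTop' (zero_lt_two (α := ℕ)))
  have hs : Complex.sin (Real.pi * (2 * y)) / (2 * Complex.sin (Real.pi * y)) =
      Complex.cos (Real.pi * y) := by
    rw [show (Real.pi : ℂ) * (2 * y) = 2 * (Real.pi * y) by ring, Complex.sin_two_mul]
    field_simp
  have hsplit : ∀ N : ℕ, ∏ j ∈ Finset.range (2 * N), (1 - (2 * y) ^ 2 / ((j : ℂ) + 1) ^ 2) =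
      (∏ j ∈ Finset.range N, (1 - y ^ 2 / ((j : ℂ) + 1 / 2) ^ 2)) *
        ∏ j ∈ Finset.range N, (1 - y ^ 2 / ((j : ℂ) + 1) ^ 2) := fun N => by
    induction N with
    | zero => simp
    | succ N ih =>
      rw [Nat.mul_succ, Finset.prod_range_succ, Finset.prod_range_succ, ih,
        Finset.prod_range_succ, Finset.prod_range_succ]
      have e1 : (2 * y) ^ 2 / (((2 * N : ℕ) : ℂ) + 1) ^ 2 = y ^ 2 / ((N : ℂ) + 1 / 2) ^ 2 := by
        rw [show ((2 * N : ℕ) : ℂ) + 1 = 2 * ((N : ℂ) + 1 / 2) by push_cast; ring, mul_pow, mul_pow,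
          mul_div_mul_left _ _ (by norm_num)]
      have e2 : (2 * y) ^ 2 / (((2 * N + 1 : ℕ) : ℂ) + 1) ^ 2 = y ^ 2 / ((N : ℂ) + 1) ^ 2 := by
        rw [show ((2 * N + 1 : ℕ) : ℂ) + 1 = 2 * ((N : ℂ) + 1) by push_cast; ring, mul_pow, mul_pow,
          mul_div_mul_left _ _ (by norm_num)]
      rw [e1, e2]
      ring
  rw [← hs]
  refine (h2.div (h1.const_mul 2) (mul_ne_zero two_ne_zero hy)).congr' ?_
  filter_upwards [h1.eventually_ne hy] with N hN
  have hπ : (Real.pi : ℂ) ≠ 0 := by exact_mod_cast Real.pi_ne_zero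
  have hN' := right_ne_zero_of_mul hN
  simp only [Pi.div_apply, Function.comp_apply, id_eq, hsplit]
  generalize ∏ j ∈ Finset.range N, (1 - y ^ 2 / ((j : ℂ) + 1) ^ 2) = q at hN'
  generalize ∏ j ∈ Finset.range N, (1 - y ^ 2 / ((j : ℂ) + 1 / 2) ^ 2) = p
  field_simp

/-- The entire function `w ↦ cos √w` on the real line. -/
noncomputable def cosSqrt (w : ℝ) : ℝ :=
  if 0 ≤ w then Real.cos √w else Real.cosh √(-w)

theorem cosSqrt_of_nonpos {w : ℝ} (hw : w ≤ 0) : cosSqrt w = Real.cosh √(-w) := by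
  rcases hw.lt_or_eq with h | rfl
  · simp [cosSqrt, h]
  · simp [cosSqrt]

theorem cosSqrt_neg_sq {z : ℝ} : cosSqrt (-z ^ 2) = Real.cosh z := by
  rw [cosSqrt_of_nonpos (by nlinarith), neg_neg, Real.sqrt_sq_eq_abs, Real.cosh_abs]

theorem sqrt_lt_pi_div_two {w : ℝ} (hw : w < Real.pi ^ 2 / 4) : √w < Real.pi / 2 := by
  rw [Real.sqrt_lt' (by positivity)]
  linarith [show (Real.pi / 2) ^ 2 = Real.pi ^ 2 / 4 by ring]

theorem cosSqrt_pos {w : ℝ} (hw : w < Real.pi ^ 2 / 4) : 0 < cosSqrt w := by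
  unfold cosSqrt
  split_ifs
  · exact Real.cos_pos_of_mem_Ioo
      ⟨by linarith [Real.sqrt_nonneg w, Real.pi_pos], sqrt_lt_pi_div_two hw⟩
  · exact Real.cosh_pos _

theorem complex_cos_sqrt_ofReal (w : ℝ) : Complex.cos (Complex.sqrt w) = cosSqrt w := by
  rcases le_or_gt 0 w with h | h
  · rw [Complex.sqrt_of_nonneg (by exact_mod_cast h), cosSqrt, if_pos h]
    simp
  · have := Complex.sqrt_neg_of_nonneg (a := ((-w : ℝ) : ℂ)) (by exact_mod_cast (by linarith))
    rw [Complex.ofReal_neg, neg_neg] at this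
    rw [this, ← Complex.ofReal_neg, Complex.sqrt_of_nonneg (by exact_mod_cast (by linarith)),
      cosSqrt_of_nonpos h.le, mul_comm, Complex.cos_mul_I]
    simp

open Filter Topology in
theorem tendsto_cosSqrt_prod {w : ℝ} (hw : w < Real.pi ^ 2 / 4) :
    Tendsto (fun N : ℕ => ∏ j ∈ Finset.range N, (1 - w / (Real.pi ^ 2 * ((j : ℝ) + 1 / 2) ^ 2)))
      atTop (𝓝 (cosSqrt w)) := by
  have hπ : (Real.pi : ℂ) ≠ 0 := by exact_mod_cast Real.pi_ne_zero
  have hsq : Complex.sqrt (w : ℂ) ^ 2 = w := by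
    rw [Complex.sqrt, ← Complex.cpow_nat_mul]
    simp
  -- For `w < 0` the sine is `i sinh √(-w)`, nonzero; for `w > 0` the bound on `w` keeps `√w` inside
  -- `(0, π/2)`.
  have key : Complex.sqrt w / Real.pi = 0 ∨
      Complex.sin (Real.pi * (Complex.sqrt w / Real.pi)) ≠ 0 := by
    rw [mul_div_cancel₀ _ hπ]
    rcases eq_or_ne w 0 with rfl | hw0
    · simp
    right
    rcases hw0.lt_or_gt with h | h
    · have := Complex.sqrt_neg_of_nonneg (a := ((-w : ℝ) : ℂ)) (by exact_mod_cast (by linarith))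
      rw [Complex.ofReal_neg, neg_neg] at this
      rw [this, ← Complex.ofReal_neg, Complex.sqrt_of_nonneg (by exact_mod_cast (by linarith)),
        mul_comm, Complex.sin_mul_I, Complex.ofReal_re, ← Complex.ofReal_sinh]
      refine mul_ne_zero (Complex.ofReal_ne_zero.2 ?_) Complex.I_ne_zero
      exact (Real.sinh_pos_iff.2 (Real.sqrt_pos.2 (by linarith))).ne'
    · rw [Complex.sqrt_of_nonneg (by exact_mod_cast h.le), Complex.ofReal_re, ← Complex.ofReal_sin]
      refine Complex.ofReal_ne_zero.2 (Real.sin_pos_of_pos_of_lt_pi (Real.sqrt_pos.2 h) ?_).ne'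
      linarith [sqrt_lt_pi_div_two hw, Real.pi_pos]
  have := tendsto_cos_prod key
  rw [mul_div_cancel₀ _ hπ, complex_cos_sqrt_ofReal] at this
  have h2 := (Complex.continuous_re.tendsto _).comp this
  rw [Complex.ofReal_re] at h2
  refine h2.congr fun N => ?_
  rw [Function.comp_apply, ← Complex.ofReal_re (∏ j ∈ Finset.range N, _)]
  congr 1
  push_cast
  refine Finset.prod_congr rfl fun j _ => ?_
  rw [div_pow, hsq, div_div]

/-! ### Exponential moments of the gamma law -/

theorem gammaMeasure_Iio_zero (b r : ℝ) : gammaMeasure b r (Set.Iio 0) = 0 := by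
  rw [gammaMeasure, withDensity_apply _ measurableSet_Iio, lintegral_gammaPDF_of_nonpos le_rfl]

/-- Multiplying the `Ga(b, r)` density by `e^(sx)` gives a constant multiple of the `Ga(b, r - s)`
density. -/
theorem lintegral_exp_gammaMeasure {b r s : ℝ} (hb : 0 < b) (hr : 0 < r) (hs : s < r) :
    ∫⁻ x, ENNReal.ofReal (Real.exp (s * x)) ∂gammaMeasure b r =
      ENNReal.ofReal ((1 - s / r) ^ (-b)) := by
  have hrs : 0 < r - s := sub_pos.2 hs
  have hm : Measurable (gammaPDF b r) := (measurable_gammaPDFReal b r).ennreal_ofReal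
  rw [gammaMeasure, lintegral_withDensity_eq_lintegral_mul _ hm (by fun_prop)]
  have hc : (1 - s / r) ^ (-b) = r ^ b / (r - s) ^ b := by
    rw [Real.rpow_neg (sub_pos.2 ((div_lt_one hr).2 hs)).le, one_sub_div hr.ne',
      Real.div_rpow hrs.le hr.le, inv_div]
  have h : ∀ x, (gammaPDF b r * fun x => ENNReal.ofReal (Real.exp (s * x))) x =
      ENNReal.ofReal ((1 - s / r) ^ (-b)) * gammaPDF b (r - s) x := fun x => by
    rcases lt_or_ge x 0 with hx | hx
    · simp [gammaPDF_of_neg hx]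
    · rw [Pi.mul_apply, gammaPDF_of_nonneg hx, gammaPDF_of_nonneg hx,
        ← ENNReal.ofReal_mul (by positivity), ← ENNReal.ofReal_mul (by rw [hc]; positivity), hc]
      congr 1
      have he : Real.exp (-((r - s) * x)) = Real.exp (-(r * x)) * Real.exp (s * x) := by
        rw [← Real.exp_add]
        ring_nf
      have := (Real.rpow_pos_of_pos hrs b).ne'
      rw [he]
      field_simp
  simp_rw [h]
  rw [lintegral_const_mul' _ _ ENNReal.ofReal_ne_top, lintegral_gammaPDF_eq_one hb hrs, mul_one]

/-- The integral is monotone in `s`, and its known values for `s < r` are unbounded. -/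
theorem lintegral_exp_gammaMeasure_eq_top {b r s : ℝ} (hb : 0 < b) (hr : 0 < r) (hs : r ≤ s) :
    ∫⁻ x, ENNReal.ofReal (Real.exp (s * x)) ∂gammaMeasure b r = ⊤ := by
  by_contra hne
  set c := (∫⁻ x, ENNReal.ofReal (Real.exp (s * x)) ∂gammaMeasure b r).toReal with hc
  have hc1 : 0 < c + 1 := by positivity
  -- Chosen so that `u^(-b) = c + 1`: the moment at `r(1 - u) < r` then exceeds the supposed finite
  -- value `c`.
  set u := (c + 1) ^ (-b⁻¹) with hu
  have hu0 : 0 < u := Real.rpow_pos_of_pos hc1 _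
  have hs' : r * (1 - u) < r := by nlinarith
  have h := lintegral_exp_gammaMeasure hb hr hs'
  have hval : (1 - r * (1 - u) / r) ^ (-b) = c + 1 := by
    rw [mul_div_cancel_left₀ _ hr.ne', sub_sub_cancel, hu, ← Real.rpow_mul hc1.le, neg_mul_neg,
      inv_mul_cancel₀ hb.ne', Real.rpow_one]
  have hle : ENNReal.ofReal (c + 1) ≤ ∫⁻ x, ENNReal.ofReal (Real.exp (s * x)) ∂gammaMeasure b r := by
    rw [← hval, ← h]
    refine lintegral_mono_ae ?_
    filter_upwards [ae_nonneg_of_Iio_zero (gammaMeasure_Iio_zero b r)] with x hx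
    gcongr
    linarith
  rw [ENNReal.ofReal_le_iff_le_toReal hne, ← hc] at hle
  linarith

/-! ### Random series of gamma variables -/

theorem lintegral_prod_of_iIndepFun {Ω ι : Type*} [MeasurableSpace Ω] {μ : Measure Ω}
    (s : Finset ι) {X : ι → Ω → ℝ≥0∞} (hX : iIndepFun X μ) (hm : ∀ i, AEMeasurable (X i) μ) :
    ∫⁻ ω, ∏ i ∈ s, X i ω ∂μ = ∏ i ∈ s, ∫⁻ ω, X i ω ∂μ := by
  have : IsProbabilityMeasure μ := hX.isProbabilityMeasure
  induction s using Finset.cons_induction with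
  | empty => simp
  | cons j s hj ih =>
    simp only [← Finset.prod_apply, Finset.prod_cons, ← ih]
    exact lintegral_mul_eq_lintegral_mul_lintegral_of_indepFun' (hm j)
      (s.aemeasurable_prod fun i _ => hm i) (hX.indepFun_finsetProd_of_notMem₀ hm hj).symm

section GammaSeries

open Filter Topology

variable {Ω : Type*} [MeasurableSpace Ω] {P : Measure Ω} {g : ℕ → Ω → ℝ} {b : ℝ} {r : ℕ → ℝ}

theorem HasLaw.lintegral_eq {X : Ω → ℝ} {μ : Measure ℝ} (hX : HasLaw X μ P) {f : ℝ → ℝ≥0∞}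
    (hf : Measurable f) : ∫⁻ ω, f (X ω) ∂P = ∫⁻ x, f x ∂μ := by
  rw [← hX.map_eq, lintegral_map' hf.aemeasurable hX.aemeasurable]

theorem ae_nonneg_of_hasLaw_gamma (hg : ∀ n, HasLaw (g n) (gammaMeasure b 1) P) :
    ∀ᵐ ω ∂P, ∀ n, 0 ≤ g n ω :=
  ae_all_iff.2 fun n => ((hg n).ae_iff (measurableSet_setOfPred.1 measurableSet_Ici)).2
    (ae_nonneg_of_Iio_zero (gammaMeasure_Iio_zero b 1))

/-- By Tonelli the expected sum is `E[g] ∑ 1/r_n`, which is finite, so the nonnegative series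
converges almost surely. -/
theorem ae_summable_gamma_div (hb : 0 < b) (hg : ∀ n, HasLaw (g n) (gammaMeasure b 1) P)
    (hr : ∀ n, 0 < r n) (hsum : Summable fun n => (r n)⁻¹) :
    ∀ᵐ ω ∂P, Summable fun n => g n ω / r n := by
  set K : ℝ≥0∞ := ∫⁻ x, ENNReal.ofReal x ∂gammaMeasure b 1
  have hK : K ≠ ⊤ := by
    -- The mean is bounded through `x ≤ 2 e^(x/2)`, whose right side has a finite integral since
    -- `1/2 < 1`.
    refine ne_top_of_le_ne_top (b := 2 * ENNReal.ofReal ((1 - (1 / 2) / 1) ^ (-b)))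
      (ENNReal.mul_ne_top ENNReal.ofNat_ne_top ENNReal.ofReal_ne_top) ?_
    rw [← lintegral_exp_gammaMeasure hb one_pos (by norm_num), ← lintegral_const_mul _ (by fun_prop)]
    refine lintegral_mono fun x => ?_
    rw [← ENNReal.ofReal_ofNat 2, ← ENNReal.ofReal_mul zero_le_two]
    refine ENNReal.ofReal_le_ofReal ?_
    linarith [Real.add_one_le_exp (1 / 2 * x)]
  have hlin : ∫⁻ ω, ∑' n, ENNReal.ofReal (g n ω / r n) ∂P ≠ ⊤ := by
    rw [lintegral_tsum fun n => ((hg n).aemeasurable.div_const _).ennreal_ofReal]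
    have : ∀ n, ∫⁻ ω, ENNReal.ofReal (g n ω / r n) ∂P = K * ENNReal.ofReal (r n)⁻¹ := fun n => by
      rw [HasLaw.lintegral_eq (hg n) (f := fun x => ENNReal.ofReal (x / r n)) (by fun_prop)]
      simp_rw [div_eq_mul_inv, ENNReal.ofReal_mul' (inv_pos.2 (hr n)).le]
      rw [lintegral_mul_const _ (by fun_prop)]
    simp_rw [this]
    rw [ENNReal.tsum_mul_left]
    exact ENNReal.mul_ne_top hK hsum.tsum_ofReal_ne_top
  filter_upwards [ae_lt_top' (AEMeasurable.tsum fun n =>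
    ((hg n).aemeasurable.div_const _).ennreal_ofReal) hlin, ae_nonneg_of_hasLaw_gamma hg]
    with ω h hnn
  refine (ENNReal.summable_toReal h.ne).congr fun n => ?_
  rw [ENNReal.toReal_ofReal (div_nonneg (hnn n) (hr n).le)]

theorem aemeasurable_gamma_series (hb : 0 < b) (hg : ∀ n, HasLaw (g n) (gammaMeasure b 1) P)
    (hr : ∀ n, 0 < r n) (hsum : Summable fun n => (r n)⁻¹) :
    AEMeasurable (fun ω => ∑' n, g n ω / r n) P := by
  refine aemeasurable_of_tendsto_metrizable_ae' (f := fun N ω => ∑ n ∈ Finset.range N, g n ω / r n)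
    (fun N => Finset.aemeasurable_fun_sum _ fun n _ => (hg n).aemeasurable.div_const _) ?_
  filter_upwards [ae_summable_gamma_div hb hg hr hsum] with ω h
  exact h.hasSum.tendsto_sum_nat

theorem lintegral_exp_gamma_sum (hb : 0 < b) (hi : iIndepFun g P)
    (hg : ∀ n, HasLaw (g n) (gammaMeasure b 1) P) (hr : ∀ n, 0 < r n) {t : ℝ}
    (ht : ∀ n, t < r n) (N : ℕ) :
    ∫⁻ ω, ENNReal.ofReal (Real.exp (t * ∑ n ∈ Finset.range N, g n ω / r n)) ∂P =
      ENNReal.ofReal (∏ n ∈ Finset.range N, (1 - t / r n) ^ (-b)) := by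
  have hpos : ∀ n, 0 < 1 - t / r n := fun n => sub_pos.2 ((div_lt_one (hr n)).2 (ht n))
  have hm : ∀ n, Measurable fun x : ℝ => ENNReal.ofReal (Real.exp (t * (x / r n))) :=
    fun n => by fun_prop
  simp_rw [Finset.mul_sum, Real.exp_sum]
  simp_rw [ENNReal.ofReal_prod_of_nonneg fun _ _ => (Real.exp_pos _).le]
  have hprod := lintegral_prod_of_iIndepFun (Finset.range N) (hi.comp _ hm)
    fun n => (hm n).comp_aemeasurable (hg n).aemeasurable
  simp_rw [Function.comp_apply] at hprod
  rw [hprod, ENNReal.ofReal_prod_of_nonneg fun n _ => (Real.rpow_pos_of_pos (hpos n) _).le]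
  refine Finset.prod_congr rfl fun n _ => ?_
  have h1 : t / r n < 1 := (div_lt_one (hr n)).2 (ht n)
  have := lintegral_exp_gammaMeasure hb one_pos h1
  rw [div_one] at this
  rw [← this]
  rw [HasLaw.lintegral_eq (hg n) (hm n)]
  simp_rw [mul_div_assoc', div_mul_eq_mul_div]

theorem tendsto_lintegral_exp_gamma_series (hb : 0 < b) (hi : iIndepFun g P)
    (hg : ∀ n, HasLaw (g n) (gammaMeasure b 1) P) (hr : ∀ n, 0 < r n)
    (hsum : Summable fun n => (r n)⁻¹) {t : ℝ} (ht : ∀ n, t < r n) :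
    Tendsto (fun N => ENNReal.ofReal (∏ n ∈ Finset.range N, (1 - t / r n) ^ (-b))) atTop
      (𝓝 (∫⁻ ω, ENNReal.ofReal (Real.exp (t * ∑' n, g n ω / r n)) ∂P)) := by
  have : IsProbabilityMeasure P := hi.isProbabilityMeasure
  simp_rw [← lintegral_exp_gamma_sum hb hi hg hr ht]
  have hm : ∀ N, AEMeasurable (fun ω =>
      ENNReal.ofReal (Real.exp (t * ∑ n ∈ Finset.range N, g n ω / r n))) P := fun N =>
    (Real.measurable_exp.comp_aemeasurable ((Finset.aemeasurable_fun_sum _ fun n _ =>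
      (hg n).aemeasurable.div_const _).const_mul t)).ennreal_ofReal
  have hlim : ∀ᵐ ω ∂P, Tendsto (fun N =>
      ENNReal.ofReal (Real.exp (t * ∑ n ∈ Finset.range N, g n ω / r n))) atTop
      (𝓝 (ENNReal.ofReal (Real.exp (t * ∑' n, g n ω / r n)))) := by
    filter_upwards [ae_summable_gamma_div hb hg hr hsum] with ω h
    have := h.hasSum.tendsto_sum_nat
    exact ENNReal.tendsto_ofReal ((Real.continuous_exp.tendsto _).comp (this.const_mul t))
  -- The exponentials of the partial sums increase when `t ≥ 0` and are bounded by `1` when `t ≤ 0`.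
  rcases le_total 0 t with h0 | h0
  · refine lintegral_tendsto_of_tendsto_of_monotone hm ?_ hlim
    filter_upwards [ae_nonneg_of_hasLaw_gamma hg] with ω hnn M N hMN
    have : ∑ n ∈ Finset.range M, g n ω / r n ≤ ∑ n ∈ Finset.range N, g n ω / r n :=
      Finset.sum_le_sum_of_subset_of_nonneg (Finset.range_mono hMN)
        fun n _ _ => div_nonneg (hnn n) (hr n).le
    dsimp only
    gcongr
  · refine tendsto_lintegral_of_dominated_convergence' (fun _ => 1) hm (fun N => ?_) (by simp) hlim
    filter_upwards [ae_nonneg_of_hasLaw_gamma hg] with ω hnn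
    rw [ENNReal.ofReal_le_one, Real.exp_le_one_iff]
    exact mul_nonpos_of_nonpos_of_nonneg h0
      (Finset.sum_nonneg fun n _ => div_nonneg (hnn n) (hr n).le)

/-- The sum dominates its first term, whose exponential moment is already infinite. -/
theorem lintegral_exp_gamma_series_eq_top (hb : 0 < b)
    (hg : ∀ n, HasLaw (g n) (gammaMeasure b 1) P) (hr : ∀ n, 0 < r n)
    (hsum : Summable fun n => (r n)⁻¹) {t : ℝ} (ht : r 0 ≤ t) :
    ∫⁻ ω, ENNReal.ofReal (Real.exp (t * ∑' n, g n ω / r n)) ∂P = ⊤ := by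
  have h1 := lintegral_exp_gammaMeasure_eq_top hb one_pos ((one_le_div (hr 0)).2 ht)
  rw [← HasLaw.lintegral_eq (hg 0) (by fun_prop)] at h1
  rw [eq_top_iff, ← h1]
  refine lintegral_mono_ae ?_
  filter_upwards [ae_summable_gamma_div hb hg hr hsum, ae_nonneg_of_hasLaw_gamma hg] with ω hs hnn
  have := hs.le_tsum 0 fun n _ => div_nonneg (hnn n) (hr n).le
  rw [div_mul_eq_mul_div, mul_div_assoc]
  have ht0 : 0 ≤ t := (hr 0).le.trans ht
  gcongr

theorem ae_nonneg_gamma_series (hg : ∀ n, HasLaw (g n) (gammaMeasure b 1) P)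
    (hr : ∀ n, 0 < r n) : ∀ᵐ ω ∂P, 0 ≤ ∑' n, g n ω / r n := by
  filter_upwards [ae_nonneg_of_hasLaw_gamma hg] with ω hnn
  exact tsum_nonneg fun n => div_nonneg (hnn n) (hr n).le

end GammaSeries

/-! ### The rates and the closed form of the product -/

theorem jstarRate_eq (z : ℝ) (n : ℕ) : jstarRate z n =
    Real.pi ^ 2 * ((n : ℝ) + 1 / 2) ^ 2 / 2 * (1 - -z ^ 2 / (Real.pi ^ 2 * ((n : ℝ) + 1 / 2) ^ 2)) := by
  have : Real.pi ^ 2 * ((n : ℝ) + 1 / 2) ^ 2 ≠ 0 := by positivity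
  rw [jstarRate]
  field_simp
  ring

theorem jstarRate_pos (z : ℝ) (n : ℕ) : 0 < jstarRate z n := by
  unfold jstarRate
  positivity

theorem jstarRate_zero_le (z : ℝ) (n : ℕ) : jstarRate z 0 ≤ jstarRate z n := by
  unfold jstarRate
  gcongr
  exact n.zero_le

theorem summable_inv_jstarRate (z : ℝ) : Summable fun n => (jstarRate z n)⁻¹ := by
  have h : Summable fun n : ℕ => 1 / ((n : ℝ) + 1 / 2) ^ 2 := by
    -- The factor `4` comes from `n + 1 ≤ 2(n + 1/2)`.
    have h2 := ((Real.summable_nat_pow_inv (p := 2)).2 (by norm_num)).mul_left 4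
    have h3 := h2.comp_injective (i := fun n => n + 1) (add_left_injective 1)
    refine h3.of_nonneg_of_le (fun n => by positivity) fun n => ?_
    simp only [Function.comp_apply, ← div_eq_mul_inv]
    rw [div_le_div_iff₀ (by positivity) (by positivity)]
    push_cast
    have : (0 : ℝ) ≤ n := n.cast_nonneg
    nlinarith
  refine (h.mul_left (2 / Real.pi ^ 2)).of_nonneg_of_le (fun n => (inv_pos.2 (jstarRate_pos z n)).le)
    fun n => ?_
  rw [div_mul_div_comm, mul_one, ← inv_div]
  refine inv_anti₀ (by positivity) ?_
  unfold jstarRate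
  nlinarith [sq_nonneg z]

theorem two_mul_sub_sq_lt {z t : ℝ} (ht : t < jstarRate z 0) : 2 * t - z ^ 2 < Real.pi ^ 2 / 4 := by
  rw [jstarRate, Nat.cast_zero] at ht
  linarith

open Filter Topology in
theorem tendsto_prod_one_sub_div_jstarRate {z t : ℝ} (ht : t < jstarRate z 0) :
    Tendsto (fun N : ℕ => ∏ n ∈ Finset.range N, (1 - t / jstarRate z n)) atTop
      (𝓝 (cosSqrt (2 * t - z ^ 2) / Real.cosh z)) := by
  have hz : -z ^ 2 < Real.pi ^ 2 / 4 := by nlinarith [Real.pi_pos, sq_nonneg z]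
  rw [← cosSqrt_neg_sq]
  refine ((tendsto_cosSqrt_prod (two_mul_sub_sq_lt ht)).div (tendsto_cosSqrt_prod hz)
    (cosSqrt_pos hz).ne').congr fun N => ?_
  rw [Pi.div_apply, ← Finset.prod_div_distrib]
  refine Finset.prod_congr rfl fun n _ => ?_
  have h1 : Real.pi ^ 2 * ((n : ℝ) + 1 / 2) ^ 2 ≠ 0 := by positivity
  have h2 : 1 - -z ^ 2 / (Real.pi ^ 2 * ((n : ℝ) + 1 / 2) ^ 2) ≠ 0 := by
    have := jstarRate_pos z n
    rw [jstarRate_eq] at this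
    exact right_ne_zero_of_mul this.ne'
  rw [jstarRate_eq, one_sub_div (mul_ne_zero (div_ne_zero h1 two_ne_zero) h2),
    div_eq_div_iff h2 (mul_ne_zero (div_ne_zero h1 two_ne_zero) h2)]
  have h3 : (2 * t - z ^ 2) / (Real.pi ^ 2 * ((n : ℝ) + 1 / 2) ^ 2) *
      (Real.pi ^ 2 * ((n : ℝ) + 1 / 2) ^ 2) = 2 * t - z ^ 2 := div_mul_cancel₀ _ h1
  have h4 : -z ^ 2 / (Real.pi ^ 2 * ((n : ℝ) + 1 / 2) ^ 2) *
      (Real.pi ^ 2 * ((n : ℝ) + 1 / 2) ^ 2) = -z ^ 2 := div_mul_cancel₀ _ h1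
  -- Only `u q = 2t - z²` and `v q = -z²` matter from here on, so the identity becomes polynomial.
  generalize Real.pi ^ 2 * ((n : ℝ) + 1 / 2) ^ 2 = q at *
  generalize (2 * t - z ^ 2) / q = u at *
  generalize -z ^ 2 / q = v at *
  linear_combination (-(1 - v) / 2) * h3 + ((1 - v) / 2) * h4

theorem one_sub_div_jstarRate_pos {z t : ℝ} (ht : t < jstarRate z 0) (n : ℕ) :
    0 < 1 - t / jstarRate z n :=
  sub_pos.2 ((div_lt_one (jstarRate_pos z n)).2 (ht.trans_le (jstarRate_zero_le z n)))

/-- The moment generating function of `J*(b, z)` on its domain of finiteness. -/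
noncomputable def jstarMGF (b z t : ℝ) : ℝ :=
  (cosSqrt (2 * t - z ^ 2) / Real.cosh z) ^ (-b)

theorem jstarMGF_eq {z t : ℝ} (b : ℝ) (ht : t < jstarRate z 0) :
    jstarMGF b z t = Real.cosh z ^ b * cosSqrt (2 * t - z ^ 2) ^ (-b) := by
  have h := Real.cosh_pos z
  rw [jstarMGF, Real.div_rpow (cosSqrt_pos (two_mul_sub_sq_lt ht)).le h.le, Real.rpow_neg h.le,
    div_inv_eq_mul, mul_comm]

theorem jstarMGF_neg (b z : ℝ) {t : ℝ} (ht : 0 ≤ t) :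
    jstarMGF b z (-t) = Real.cosh z ^ b * Real.cosh √(2 * t + z ^ 2) ^ (-b) := by
  rw [jstarMGF_eq b ((neg_nonpos.2 ht).trans_lt (jstarRate_pos z 0)),
    cosSqrt_of_nonpos (by nlinarith [sq_nonneg z])]
  ring_nf

/-- Summability of `1/d_n` gives unconditional convergence; the ordered partial products identify
the value, which is positive, so the power `-b` passes to the limit. -/
theorem hasProd_jstarMGF (b : ℝ) {z t : ℝ} (ht : t < jstarRate z 0) :
    HasProd (fun n : ℕ => (1 - t / jstarRate z n) ^ (-b)) (jstarMGF b z t) := by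
  have hm : Multipliable fun n : ℕ => (1 - t / jstarRate z n) := by
    have := Real.multipliable_one_add_of_summable ((summable_inv_jstarRate z).mul_left (-t))
    refine this.congr fun n => ?_
    rw [neg_mul, ← sub_eq_add_neg, div_eq_mul_inv]
  have hp := hm.hasProd
  rw [tendsto_nhds_unique hp.tendsto_prod_nat (tendsto_prod_one_sub_div_jstarRate ht)] at hp
  have hpos := div_pos (cosSqrt_pos (two_mul_sub_sq_lt ht)) (Real.cosh_pos z)
  refine (Filter.Tendsto.rpow_const hp (Or.inl hpos.ne')).congr fun s => ?_
  exact (Real.finsetProd_rpow _ _ (fun n _ => (one_sub_div_jstarRate_pos ht n).le) _).symm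

/-! ### The law of the series and its exponential moments -/

section Law

variable {Ω : Type*} [MeasurableSpace Ω] {P : Measure Ω} {g : ℕ → Ω → ℝ} {b : ℝ}

theorem lintegral_exp_map_jstarSeries (hb : 0 < b) (z : ℝ) (hi : iIndepFun g P)
    (hg : ∀ n, HasLaw (g n) (gammaMeasure b 1) P) {t : ℝ} (ht : t < jstarRate z 0) :
    ∫⁻ x, ENNReal.ofReal (Real.exp (t * x)) ∂(P.map fun ω => ∑' n, g n ω / jstarRate z n) =
      ENNReal.ofReal (jstarMGF b z t) := by
  rw [lintegral_map' (by fun_prop)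
    (aemeasurable_gamma_series hb hg (jstarRate_pos z) (summable_inv_jstarRate z))]
  exact tendsto_nhds_unique (tendsto_lintegral_exp_gamma_series hb hi hg (jstarRate_pos z)
    (summable_inv_jstarRate z) fun n => ht.trans_le (jstarRate_zero_le z n))
    (ENNReal.tendsto_ofReal (hasProd_jstarMGF b ht).tendsto_prod_nat)

theorem integral_eq_toReal_lintegral_exp (μ : Measure ℝ) (t : ℝ) :
    ∫ x, Real.exp (t * x) ∂μ = (∫⁻ x, ENNReal.ofReal (Real.exp (t * x)) ∂μ).toReal :=
  integral_eq_lintegral_of_nonneg_ae (Filter.Eventually.of_forall fun _ => (Real.exp_pos _).le)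
    (by fun_prop)

theorem jstarMGF_pos (b : ℝ) {z t : ℝ} (ht : t < jstarRate z 0) : 0 < jstarMGF b z t :=
  Real.rpow_pos_of_pos (div_pos (cosSqrt_pos (two_mul_sub_sq_lt ht)) (Real.cosh_pos z)) _

theorem isJStar_map_jstarSeries (hb : 0 < b) (z : ℝ) (hi : iIndepFun g P)
    (hg : ∀ n, HasLaw (g n) (gammaMeasure b 1) P) :
    IsJStar b z (P.map fun ω => ∑' n, g n ω / jstarRate z n) where
  isProbabilityMeasure :=
    have := hi.isProbabilityMeasure
    Measure.isProbabilityMeasure_map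
      (aemeasurable_gamma_series hb hg (jstarRate_pos z) (summable_inv_jstarRate z))
  nonneg_support := by
    rw [Measure.map_apply_of_aemeasurable
      (aemeasurable_gamma_series hb hg (jstarRate_pos z) (summable_inv_jstarRate z))
      measurableSet_Iio]
    have := ae_nonneg_gamma_series hg (jstarRate_pos z)
    rw [ae_iff] at this
    simpa [Set.preimage] using this
  laplace t ht := by
    have ht' := (neg_nonpos.2 ht).trans_lt (jstarRate_pos z 0)
    simp_rw [← neg_mul]
    rw [integral_eq_toReal_lintegral_exp, lintegral_exp_map_jstarSeries hb z hi hg ht',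
      ENNReal.toReal_ofReal (jstarMGF_pos b ht').le, jstarMGF_neg b z ht]

end Law

theorem IsJStar.lintegral_laplace {b z : ℝ} {μ : Measure ℝ} (h : IsJStar b z μ) {t : ℝ}
    (ht : 0 ≤ t) : ∫⁻ x, ENNReal.ofReal (Real.exp (-(t * x))) ∂μ =
      ENNReal.ofReal (Real.cosh z ^ b * Real.cosh √(2 * t + z ^ 2) ^ (-b)) := by
  rw [← h.laplace t ht, ofReal_integral_eq_lintegral_ofReal _
    (Filter.Eventually.of_forall fun _ => (Real.exp_pos _).le)]
  -- A non-integrable function has Bochner integral `0`, whereas the prescribed transform is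
  -- positive.
  by_contra hni
  have := h.laplace t ht
  rw [integral_undef hni] at this
  have h1 := Real.rpow_pos_of_pos (Real.cosh_pos z) b
  have h2 := Real.rpow_pos_of_pos (Real.cosh_pos √(2 * t + z ^ 2)) (-b)
  exact (mul_pos h1 h2).ne this

theorem IsJStar.unique {b z : ℝ} {μ ν : Measure ℝ} (hμ : IsJStar b z μ) (hν : IsJStar b z ν) :
    μ = ν := by
  have := hμ.isProbabilityMeasure
  have := hν.isProbabilityMeasure
  refine ext_of_laplace_eq hμ.nonneg_support hν.nonneg_support fun t ht => ?_
  rw [hμ.lintegral_laplace ht, hν.lintegral_laplace ht]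

theorem exists_isJStar {b : ℝ} (hb : 0 < b) (z : ℝ) : ∃ μ, IsJStar b z μ := by
  have := isProbabilityMeasure_gammaMeasure hb one_pos
  obtain ⟨Ω, _, P, g, -, hg, hi, -⟩ := exists_iid ℕ (gammaMeasure b 1)
  exact ⟨_, isJStar_map_jstarSeries hb z hi hg⟩

/-- The definition speaks only of exponents `≤ 0`; identifying `μ` with the law of the series
extends the formula up to `d_0`. -/
theorem IsJStar.lintegral_exp {b z : ℝ} {μ : Measure ℝ} (hb : 0 < b) (h : IsJStar b z μ) {t : ℝ}
    (ht : t < jstarRate z 0) :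
    ∫⁻ x, ENNReal.ofReal (Real.exp (t * x)) ∂μ = ENNReal.ofReal (jstarMGF b z t) := by
  have := isProbabilityMeasure_gammaMeasure hb one_pos
  obtain ⟨Ω, _, P, g, -, hg, hi, -⟩ := exists_iid ℕ (gammaMeasure b 1)
  rw [h.unique (isJStar_map_jstarSeries hb z hi hg), lintegral_exp_map_jstarSeries hb z hi hg ht]

theorem IsJStar.lintegral_exp_eq_top {b z : ℝ} {μ : Measure ℝ} (hb : 0 < b) (h : IsJStar b z μ)
    {t : ℝ} (ht : jstarRate z 0 ≤ t) : ∫⁻ x, ENNReal.ofReal (Real.exp (t * x)) ∂μ = ⊤ := by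
  have := isProbabilityMeasure_gammaMeasure hb one_pos
  obtain ⟨Ω, _, P, g, -, hg, hi, -⟩ := exists_iid ℕ (gammaMeasure b 1)
  rw [h.unique (isJStar_map_jstarSeries hb z hi hg), lintegral_map' (by fun_prop)
    (aemeasurable_gamma_series hb hg (jstarRate_pos z) (summable_inv_jstarRate z))]
  exact lintegral_exp_gamma_series_eq_top hb hg (jstarRate_pos z) (summable_inv_jstarRate z) ht

theorem IsJStar.integrable_exp_iff {b z : ℝ} {μ : Measure ℝ} (hb : 0 < b) (h : IsJStar b z μ)
    (t : ℝ) : Integrable (fun x => Real.exp (t * x)) μ ↔ t < jstarRate z 0 := by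
  rw [← lintegral_ofReal_ne_top_iff_integrable (by fun_prop)
    (Filter.Eventually.of_forall fun _ => (Real.exp_pos _).le)]
  refine ⟨fun hne => ?_, fun ht => ?_⟩
  · by_contra hle
    exact hne (h.lintegral_exp_eq_top hb (not_lt.1 hle))
  · rw [h.lintegral_exp hb ht]
    exact ENNReal.ofReal_ne_top

theorem IsJStar.integral_exp {b z : ℝ} {μ : Measure ℝ} (hb : 0 < b) (h : IsJStar b z μ) {t : ℝ}
    (ht : t < jstarRate z 0) : ∫ x, Real.exp (t * x) ∂μ = jstarMGF b z t := by
  rw [integral_eq_toReal_lintegral_exp, h.lintegral_exp hb ht,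
    ENNReal.toReal_ofReal (jstarMGF_pos b ht).le]

/-! ### Absolute continuity and the density of `PG(b)` -/

/-- `J*(b, z)` is the convolution of a probability measure with `Ga(b, d_0)`. -/
theorem IsJStar.absolutelyContinuous {b z : ℝ} {μ : Measure ℝ} (hb : 0 < b)
    (h : IsJStar b z μ) : μ ≪ volume := by
  have hr0 := jstarRate_pos z 0
  have := h.isProbabilityMeasure
  have := isProbabilityMeasure_gammaMeasure hb one_pos
  have := isProbabilityMeasure_gammaMeasure hb hr0
  obtain ⟨Ω, _, P, g, -, hg, hi, _⟩ := exists_iid ℕ (gammaMeasure b 1)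
  -- The rates of the series without its first term; that term supplies the gamma factor.
  let r : ℕ → ℝ := fun n => jstarRate z (n + 1)
  have hr : ∀ n, 0 < r n := fun n => jstarRate_pos z (n + 1)
  have hsum : Summable fun n => (r n)⁻¹ :=
    (summable_inv_jstarRate z).comp_injective (add_left_injective 1)
  have hS := aemeasurable_gamma_series hb hg hr hsum
  set κ := P.map fun ω => ∑' n, g n ω / r n with hκ
  have hκp : IsProbabilityMeasure κ := Measure.isProbabilityMeasure_map hS
  have hκ0 : ∀ᵐ x ∂κ, 0 ≤ x :=
    (ae_map_iff hS measurableSet_Ici).2 (ae_nonneg_gamma_series hg hr)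
  suffices hμ : μ = κ ∗ gammaMeasure b (jstarRate z 0) by
    rw [hμ]
    exact Measure.conv_absolutelyContinuous (withDensity_absolutelyContinuous _ _)
  refine ext_of_laplace_eq h.nonneg_support ?_ fun t ht => ?_
  · rw [← lintegral_indicator_one measurableSet_Iio, Measure.lintegral_conv
      (measurable_one.indicator measurableSet_Iio)]
    refine (lintegral_congr_ae (g := fun _ => 0) ?_).trans lintegral_zero
    filter_upwards [hκ0] with x hx
    refine (lintegral_congr_ae (g := fun _ => 0) ?_).trans lintegral_zero
    filter_upwards [ae_nonneg_of_Iio_zero (gammaMeasure_Iio_zero b _)] with y hy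
    simp [add_nonneg hx hy]
  · simp_rw [← neg_mul]
    have ht' : -t < jstarRate z 0 := (neg_nonpos.2 ht).trans_lt hr0
    have hlt : ∀ n, -t < r n := fun n => ht'.trans_le (jstarRate_zero_le z _)
    rw [Measure.lintegral_conv (by fun_prop), h.lintegral_exp hb ht']
    simp_rw [mul_add, Real.exp_add, ENNReal.ofReal_mul (Real.exp_pos _).le]
    simp_rw [lintegral_const_mul' _ _ ENNReal.ofReal_ne_top]
    rw [lintegral_mul_const _ (by fun_prop), lintegral_exp_gammaMeasure hb hr0 ht', hκ,
      lintegral_map' (by fun_prop) hS]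
    have h1 := ENNReal.Tendsto.mul_const
      (tendsto_lintegral_exp_gamma_series hb hi hg hr hsum hlt)
      (Or.inr (ENNReal.ofReal_ne_top (r := (1 - -t / jstarRate z 0) ^ (-b))))
    refine tendsto_nhds_unique ?_ h1
    have h2 := (Filter.tendsto_add_atTop_iff_nat 1).2 (hasProd_jstarMGF b ht').tendsto_prod_nat
    refine (ENNReal.tendsto_ofReal h2).congr fun N => ?_
    rw [Finset.prod_range_succ', ENNReal.ofReal_mul (Finset.prod_nonneg fun n _ =>
      (Real.rpow_pos_of_pos (one_sub_div_jstarRate_pos ht' _) _).le)]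

/-- The density is the Radon–Nikodym derivative of the law of `X/4` for `X` distributed as `J*(b,
0)`. Absolute continuity also excludes an atom at `0`, so restricting to `(0, ∞)` loses no mass. -/
theorem exists_isPolyaGammaDensity {b : ℝ} (hb : 0 < b) : ∃ p, IsPolyaGammaDensity b p := by
  obtain ⟨μ, hμ⟩ := exists_isJStar hb 0
  have := hμ.isProbabilityMeasure
  have h4 : Measurable fun x : ℝ => x / 4 := by fun_prop
  set ν := μ.map fun x => x / 4 with hν
  have hac : ν ≪ volume := by
    refine Measure.AbsolutelyContinuous.mk fun s hs h0 => ?_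
    rw [hν, Measure.map_apply h4 hs]
    refine hμ.absolutelyContinuous hb ?_
    have : (fun x : ℝ => x / 4) ⁻¹' s = (fun x : ℝ => x * 4⁻¹) ⁻¹' s := by
      simp_rw [div_eq_mul_inv]
    rw [this, Real.volume_preimage_mul_right (by norm_num), h0, mul_zero]
  have hpos : ∀ᵐ x ∂ν, x ∈ Set.Ioi (0 : ℝ) := by
    have h1 : ∀ᵐ x ∂ν, 0 ≤ x := by
      refine (ae_map_iff h4.aemeasurable measurableSet_Ici).2 ?_
      filter_upwards [ae_nonneg_of_Iio_zero hμ.nonneg_support] with x hx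
      positivity
    have h2 : ∀ᵐ x ∂ν, x ≠ 0 := by
      rw [ae_iff]
      simpa using hac (Real.volume_singleton (a := 0))
    filter_upwards [h1, h2] with x hx hx0
    exact lt_of_le_of_ne hx hx0.symm
  refine ⟨ν.rnDeriv volume, Measure.measurable_rnDeriv _ _, fun t ht => ?_⟩
  have hm : Measurable fun x : ℝ => ENNReal.ofReal (Real.exp (-(t * x))) := by fun_prop
  calc ∫⁻ x in Set.Ioi (0 : ℝ), ENNReal.ofReal (Real.exp (-(t * x))) * ν.rnDeriv volume x
      = ∫⁻ x in Set.Ioi (0 : ℝ), ENNReal.ofReal (Real.exp (-(t * x))) ∂ν := by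
        conv_rhs => rw [← Measure.withDensity_rnDeriv_eq ν volume hac]
        rw [setLIntegral_withDensity_eq_setLIntegral_mul _ (Measure.measurable_rnDeriv _ _) hm
          measurableSet_Ioi]
        simp_rw [Pi.mul_apply, mul_comm]
    _ = ∫⁻ x, ENNReal.ofReal (Real.exp (-(t * x))) ∂ν := by
        rw [Measure.restrict_eq_self_of_ae_mem hpos]
    _ = ∫⁻ x, ENNReal.ofReal (Real.exp (-(t / 4 * x))) ∂μ := by
        rw [hν, lintegral_map hm h4]
        refine lintegral_congr fun x => ?_
        ring_nf
    _ = ENNReal.ofReal (Real.cosh √(t / 2) ^ (-b)) := by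
        rw [hμ.lintegral_laplace (by positivity), Real.cosh_zero, Real.one_rpow, one_mul]
        ring_nf

/-! ### The tilted laws `PG(b, z)` -/

theorem IsPolyaGammaDensity.laplace_withDensity {b : ℝ} {p : ℝ → ℝ≥0∞}
    (h : IsPolyaGammaDensity b p) {t : ℝ} (ht : 0 ≤ t) :
    ∫⁻ x, ENNReal.ofReal (Real.exp (-(t * x)))
        ∂(volume.restrict (Set.Ioi (0 : ℝ))).withDensity p =
      ENNReal.ofReal (Real.cosh √(t / 2) ^ (-b)) := by
  rw [← h.laplace t ht, lintegral_withDensity_eq_lintegral_mul _ h.measurable (by fun_prop)]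
  simp_rw [Pi.mul_apply, mul_comm]

theorem withDensity_Ioi_apply_Iio (f : ℝ → ℝ≥0∞) :
    (volume.restrict (Set.Ioi (0 : ℝ))).withDensity f (Set.Iio 0) = 0 := by
  refine withDensity_absolutelyContinuous _ _ ?_
  rw [Measure.restrict_apply measurableSet_Iio]
  convert measure_empty (μ := (volume : Measure ℝ))
  ext x
  simp only [Set.mem_inter_iff, Set.mem_Iio, Set.mem_Ioi, Set.mem_empty_iff_false, iff_false]
  exact fun h => h.1.asymm h.2

/-- A density is determined only almost everywhere, so uniqueness is stated for the measures. -/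
theorem IsPolyaGammaDensity.withDensity_eq {b : ℝ} {p q : ℝ → ℝ≥0∞}
    (hp : IsPolyaGammaDensity b p) (hq : IsPolyaGammaDensity b q) :
    (volume.restrict (Set.Ioi (0 : ℝ))).withDensity p =
      (volume.restrict (Set.Ioi (0 : ℝ))).withDensity q := by
  have hfin : ∀ {p : ℝ → ℝ≥0∞}, IsPolyaGammaDensity b p →
      IsFiniteMeasure ((volume.restrict (Set.Ioi (0 : ℝ))).withDensity p) := fun hp => by
    have := hp.laplace_withDensity le_rfl
    refine ⟨?_⟩
    rw [← lintegral_one]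
    simpa using this.trans_lt ENNReal.ofReal_lt_top
  have := hfin hp
  have := hfin hq
  refine ext_of_laplace_eq (withDensity_Ioi_apply_Iio p) (withDensity_Ioi_apply_Iio q)
    fun t ht => ?_
  rw [hp.laplace_withDensity ht, hq.laplace_withDensity ht]

theorem measurable_polyaGammaTilt (b z : ℝ) : Measurable fun x : ℝ =>
    ENNReal.ofReal (Real.cosh (z / 2) ^ b * Real.exp (-(x * z ^ 2 / 2))) := by
  fun_prop

theorem IsPolyaGamma.unique {b z : ℝ} {ν ν' : Measure ℝ} (h : IsPolyaGamma b z ν)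
    (h' : IsPolyaGamma b z ν') : ν = ν' := by
  obtain ⟨p, hp, rfl⟩ := h
  obtain ⟨q, hq, rfl⟩ := h'
  have hmul : ∀ {p : ℝ → ℝ≥0∞}, IsPolyaGammaDensity b p →
      (volume.restrict (Set.Ioi (0 : ℝ))).withDensity
        (fun x => ENNReal.ofReal (Real.cosh (z / 2) ^ b * Real.exp (-(x * z ^ 2 / 2))) * p x) =
      ((volume.restrict (Set.Ioi (0 : ℝ))).withDensity p).withDensity
        fun x => ENNReal.ofReal (Real.cosh (z / 2) ^ b * Real.exp (-(x * z ^ 2 / 2))) := fun hp => by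
    rw [← withDensity_mul _ hp.measurable (measurable_polyaGammaTilt b z), mul_comm]
    rfl
  rw [hmul hp, hmul hq, hp.withDensity_eq hq]

/-- The tilt replaces `t` by `t + z²/2`. The right side is written as the transform of `J*(b, z/2)`
at `t/4`, ready for comparison with `X/4`. -/
theorem IsPolyaGamma.lintegral_laplace {b z : ℝ} {ν : Measure ℝ} (h : IsPolyaGamma b z ν) {t : ℝ}
    (ht : 0 ≤ t) : ∫⁻ x, ENNReal.ofReal (Real.exp (-(t * x))) ∂ν =
      ENNReal.ofReal (Real.cosh (z / 2) ^ b *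
        Real.cosh √(2 * (t / 4) + (z / 2) ^ 2) ^ (-b)) := by
  obtain ⟨p, hp, rfl⟩ := h
  have hc : 0 ≤ Real.cosh (z / 2) ^ b := (Real.rpow_pos_of_pos (Real.cosh_pos _) _).le
  have hm : Measurable fun x =>
      ENNReal.ofReal (Real.cosh (z / 2) ^ b * Real.exp (-(x * z ^ 2 / 2))) * p x :=
    (measurable_polyaGammaTilt b z).mul hp.measurable
  rw [lintegral_withDensity_eq_lintegral_mul _ hm (by fun_prop), ENNReal.ofReal_mul hc,
    show 2 * (t / 4) + (z / 2) ^ 2 = (t + z ^ 2 / 2) / 2 by ring,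
    ← hp.laplace (t + z ^ 2 / 2) (by positivity), ← lintegral_const_mul' _ _ ENNReal.ofReal_ne_top]
  refine lintegral_congr fun x => ?_
  have he : Real.exp (-((t + z ^ 2 / 2) * x)) =
      Real.exp (-(x * z ^ 2 / 2)) * Real.exp (-(t * x)) := by
    rw [← Real.exp_add]
    ring_nf
  rw [he, ENNReal.ofReal_mul (Real.exp_pos _).le]
  simp only [Pi.mul_apply]
  rw [ENNReal.ofReal_mul hc]
  ring

theorem exists_isPolyaGamma {b : ℝ} (hb : 0 < b) (z : ℝ) : ∃ ν, IsPolyaGamma b z ν := by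
  obtain ⟨p, hp⟩ := exists_isPolyaGammaDensity hb
  exact ⟨_, p, hp, rfl⟩

theorem IsJStar.isPolyaGamma_map {b z : ℝ} (hb : 0 < b) {μ : Measure ℝ}
    (h : IsJStar b (z / 2) μ) : IsPolyaGamma b z (μ.map fun x => x / 4) := by
  obtain ⟨ν, hν⟩ := exists_isPolyaGamma hb z
  have := h.isProbabilityMeasure
  have h4 : Measurable fun x : ℝ => x / 4 := by fun_prop
  have hfin : IsFiniteMeasure ν := by
    have := hν.lintegral_laplace le_rfl
    refine ⟨?_⟩
    rw [← lintegral_one]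
    simpa only [zero_mul, neg_zero, Real.exp_zero, ENNReal.ofReal_one] using
      this.trans_lt ENNReal.ofReal_lt_top
  have h0 : ν (Set.Iio 0) = 0 := by
    obtain ⟨p, -, rfl⟩ := hν
    exact withDensity_Ioi_apply_Iio _
  have heq : (μ.map fun x => x / 4) = ν := by
    refine ext_of_laplace_eq ?_ h0 fun t ht => ?_
    · rw [Measure.map_apply h4 measurableSet_Iio]
      refine measure_mono_null (fun x hx => ?_) h.nonneg_support
      simp only [Set.mem_preimage, Set.mem_Iio] at hx ⊢
      linarith
    · rw [lintegral_map (by fun_prop) h4, hν.lintegral_laplace ht,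
        ← h.lintegral_laplace (by positivity)]
      refine lintegral_congr fun x => ?_
      ring_nf
  rwa [heq]

/-! ### Complex form of the moment generating function and conclusion -/

/-- For `t < d_0` both bases are positive reals, so the principal complex powers agree with the real
ones. -/
theorem ofReal_jstarMGF {z t : ℝ} (b : ℝ) (ht : t < jstarRate z 0) :
    (jstarMGF b z t : ℂ) = Complex.cosh (z : ℂ) ^ (b : ℂ) *
      Complex.cos (Complex.sqrt (2 * (t : ℂ) - (z : ℂ) ^ 2)) ^ (-(b : ℂ)) := by
  have := complex_cos_sqrt_ofReal (2 * t - z ^ 2)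
  push_cast at this
  rw [jstarMGF_eq b ht, this, Complex.ofReal_mul, Complex.ofReal_cpow (Real.cosh_pos z).le,
    Complex.ofReal_cpow (cosSqrt_pos (two_mul_sub_sq_lt ht)).le]
  push_cast
  rfl

theorem mainTheorem10 (b z : ℝ) (hb : 0 < b) (hz : 0 ≤ z) :
    -- both distributions exist and are unique
    (∃! μ : Measure ℝ, IsJStar b z μ) ∧
    (∃! ν : Measure ℝ, IsPolyaGamma b z ν) ∧
    -- `PG(b, z)` is the law of `X / 4` with `X` distributed as `J*(b, z / 2)`
    (∀ μ : Measure ℝ, IsJStar b (z / 2) μ → IsPolyaGamma b z (μ.map (fun x => x / 4))) ∧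
    ∀ μ : Measure ℝ, IsJStar b z μ →
      -- the product form of the Laplace transform
      (∀ t : ℝ, -jstarRate z 0 < t →
        HasProd (fun n : ℕ => (1 + t / jstarRate z n) ^ (-b)) (∫ x, Real.exp (-(t * x)) ∂μ)) ∧
      -- the moment generating function is finite exactly on `t < d_0`, with its two formulas there
      (∀ t : ℝ, Integrable (fun x => Real.exp (t * x)) μ ↔ t < jstarRate z 0) ∧
      (∀ t : ℝ, t < jstarRate z 0 →
        HasProd (fun n : ℕ => (1 - t / jstarRate z n) ^ (-b)) (mgf id μ t) ∧
        ((mgf id μ t : ℝ) : ℂ) = Complex.cosh (z : ℂ) ^ (b : ℂ) *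
          Complex.cos (Complex.sqrt (2 * (t : ℂ) - (z : ℂ) ^ 2)) ^ (-(b : ℂ))) ∧
      -- the representation as an infinite sum of independent gamma variables
      (∀ (Ω : Type*) [MeasurableSpace Ω] (P : Measure Ω) [IsProbabilityMeasure P]
        (g : ℕ → Ω → ℝ), iIndepFun g P → (∀ n, HasLaw (g n) (gammaMeasure b 1) P) →
        (∀ᵐ ω ∂P, Summable (fun n : ℕ => g n ω / jstarRate z n)) ∧
        HasLaw (fun ω => ∑' n : ℕ, g n ω / jstarRate z n) μ P) := by
  refine ⟨?_, ?_, fun μ hμ => hμ.isPolyaGamma_map hb, fun μ hμ => ⟨fun t ht => ?_,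
    hμ.integrable_exp_iff hb, fun t ht => ?_, fun Ω _ P _ g hi hg => ?_⟩⟩
  · obtain ⟨μ, hμ⟩ := exists_isJStar hb z
    exact ⟨μ, hμ, fun ν hν => hν.unique hμ⟩
  · obtain ⟨ν, hν⟩ := exists_isPolyaGamma hb z
    exact ⟨ν, hν, fun ν' hν' => hν'.unique hν⟩
  · have ht' : -t < jstarRate z 0 := neg_lt.1 ht
    simp_rw [← neg_mul]
    rw [hμ.integral_exp hb ht']
    simpa only [neg_div, sub_neg_eq_add] using hasProd_jstarMGF b ht'
  · have hmgf : mgf id μ t = jstarMGF b z t := hμ.integral_exp hb ht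
    rw [hmgf]
    exact ⟨hasProd_jstarMGF b ht, ofReal_jstarMGF b ht⟩
  · exact ⟨ae_summable_gamma_div hb hg (jstarRate_pos z) (summable_inv_jstarRate z),
      aemeasurable_gamma_series hb hg (jstarRate_pos z) (summable_inv_jstarRate z),
      (isJStar_map_jstarSeries hb z hi hg).unique hμ⟩
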